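/- Let $A_0,A_1,\dots,A_p\in\mathbb{R}^{n\times n}$ and $B\in\mathbb{R}^{n\times m}$, let $\mathcal{P}\subset\mathbb{R}^p$ be a nonempty polytope (the convex hull of finitely many points), and put $A(\rho)=A_0+\sum_{i=1}^p\rho_iA_i$. Let $R\in\mathbb{R}^{m\times m}$ be symmetric positive definite and $Q\in\mathbb{R}^{n\times n}$ symmetric positive semidefinite. Assume that for every $\rho\in\mathcal{P}$ the pair $(A(\rho),B)$ is stabilizable (there is $K$ such that all eigenvalues of $A(\rho)-BK$ have negative real part) and the pair $(A(\rho),\sqrt{Q})$ is detectable (there is $L$ such that all eigenvalues of $A(\rho)-L\sqrt{Q}$ have negative real part), where $\sqrt{Q}$ is the positive semidefinite square root of $Q$. Then for every $\rho\in\mathcal{P}$ the algebraic Riccati equation $$A(\rho)^\top P+PA(\rho)-PBR^{-1}B^\top P+Q=0$$ has exactly one positive semidefinite solution $P^*(\rho)$, and $P^*(\rho)-X$ is positive semidefinite for every symmetric solution $X$. Let $K^*_\rho=R^{-1}B^\top P^*(\rho)$ be the optimal LQR gain. The map $\rho\mapsto K^*_\rho$ is continuous on $\mathcal{P}$, and the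 set $\mathcal{K}^*=\{K^*_\rho:\rho\in\mathcal{P}\}\subset\mathbb{R}^{m\times n}$ is compact and path-connected. -/

import Mathlib

open scoped Matrix MatrixOrder

noncomputable section

namespace LQR

/-- A polytope: the convex hull of finitely many points (such a set is convex and compact). -/
def IsPolytope {E : Type*} [AddCommGroup E] [Module ℝ E] (S : Set E) : Prop :=
  ∃ V : Set E, V.Finite ∧ S = convexHull ℝ V

/-- Hurwitz matrix: all complex eigenvalues have strictly negative real part. -/
def IsHurwitz {n : ℕ} (A : Matrix (Fin n) (Fin n) ℝ) : Prop :=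
  ∀ z ∈ spectrum ℂ (A.map (algebraMap ℝ ℂ)), z.re < 0

/-- `(A, B)` is stabilizable: some state feedback makes `A - B K` Hurwitz. -/
def Stabilizable {n m : ℕ} (A : Matrix (Fin n) (Fin n) ℝ) (B : Matrix (Fin n) (Fin m) ℝ) : Prop :=
  ∃ K : Matrix (Fin m) (Fin n) ℝ, IsHurwitz (A - B * K)

/-- `(A, C)` is detectable: some output injection makes `A - L C` Hurwitz. -/
def Detectable {n q : ℕ} (A : Matrix (Fin n) (Fin n) ℝ) (C : Matrix (Fin q) (Fin n) ℝ) : Prop :=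
  ∃ L : Matrix (Fin n) (Fin q) ℝ, IsHurwitz (A - L * C)

/-- The affine parameter dependence `A(ρ) = A₀ + ∑ᵢ ρᵢ Aᵢ`. -/
def systemMatrix {n p : ℕ} (A₀ : Matrix (Fin n) (Fin n) ℝ)
    (A₁ : Fin p → Matrix (Fin n) (Fin n) ℝ) (ρ : EuclideanSpace ℝ (Fin p)) :
    Matrix (Fin n) (Fin n) ℝ :=
  A₀ + ∑ i, ρ i • A₁ i

/-- `P` solves the continuous-time algebraic Riccati equation
`Aᵀ P + P A - P B R⁻¹ Bᵀ P + Q = 0`. -/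
def SolvesCARE {n m : ℕ} (A : Matrix (Fin n) (Fin n) ℝ) (B : Matrix (Fin n) (Fin m) ℝ)
    (Q : Matrix (Fin n) (Fin n) ℝ) (R : Matrix (Fin m) (Fin m) ℝ)
    (P : Matrix (Fin n) (Fin n) ℝ) : Prop :=
  Aᵀ * P + P * A - P * B * R⁻¹ * Bᵀ * P + Q = 0

open Classical in
/-- `P*`: the positive semidefinite solution of the Riccati equation
(the value `0` is used if there is none). -/
def careSolution {n m : ℕ} (A : Matrix (Fin n) (Fin n) ℝ) (B : Matrix (Fin n) (Fin m) ℝ)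
    (Q : Matrix (Fin n) (Fin n) ℝ) (R : Matrix (Fin m) (Fin m) ℝ) :
    Matrix (Fin n) (Fin n) ℝ :=
  if h : ∃ P : Matrix (Fin n) (Fin n) ℝ, P.PosSemidef ∧ SolvesCARE A B Q R P
  then h.choose else 0

/-- The optimal LQR gain `K* = R⁻¹ Bᵀ P*`. -/
def optimalGain {n m : ℕ} (A : Matrix (Fin n) (Fin n) ℝ) (B : Matrix (Fin n) (Fin m) ℝ)
    (Q : Matrix (Fin n) (Fin n) ℝ) (R : Matrix (Fin m) (Fin m) ℝ) :
    Matrix (Fin m) (Fin n) ℝ :=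
  R⁻¹ * Bᵀ * careSolution A B Q R

end LQR

end

/-!
The Cayley transform of a Hurwitz matrix `F` has its spectrum in the open unit disc, so its powers
tend to `0`. It turns a Lyapunov inequality into a Stein inequality `Mᵀ X M ≤ X`, and iterating the
latter gives `Fᵀ X + X F ≤ 0 → 0 ≤ X`: the inverse Lyapunov operator reverses order.

Completing the square, `(A - B K)ᵀ X + X (A - B K) + Q + Kᵀ R K` is the Riccati residual of `X` plus
`(K - R⁻¹ Bᵀ X)ᵀ R (K - R⁻¹ Bᵀ X)`, for every gain `K`. Hence policy iteration started at a
stabilizing gain decreases to a positive semidefinite Riccati solution. Detectability makes the gain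
of such a solution stabilizing, because the feedback matrix agrees with `A - L √Q` on any undamped
mode; the order reversal then puts every symmetric solution below it, which gives maximality and
uniqueness.

For continuity at `ρ`, solve a Lyapunov equation for a stabilizing gain at `ρ` strictly. By openness
the strict inequality persists nearby, so one matrix bounds all Riccati solutions near `ρ`. The
positive semidefinite ones stay in a compact order interval, where each cluster point is a positive
semidefinite solution at `ρ`, hence equal to `P*(ρ)`.
-/

open Filter Topology

namespace LQR

open Matrix

section Order

theorem exists_tendsto_of_antitone {α β : Type*} [TopologicalSpace α] [PartialOrder α]
    [OrderClosedTopology α] [CompactIccSpace α] [Preorder β] [IsDirectedOrder β] [Nonempty β]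
    {u : β → α} (hu : Antitone u) (hb : BddBelow (Set.range u)) :
    ∃ a, Tendsto u atTop (𝓝 a) := by
  obtain ⟨b, hb⟩ := hb
  obtain ⟨i₀⟩ := ‹Nonempty β›
  have hmem : ∀ᶠ i in atTop, u i ∈ Set.Icc b (u i₀) :=
    (eventually_ge_atTop i₀).mono fun i hi => ⟨hb ⟨i, rfl⟩, hu hi⟩
  have hle {z : α} (hz : MapClusterPt z atTop u) (i : β) : z ≤ u i :=
    isClosed_Iic.mem_of_mapClusterPt hz ((eventually_ge_atTop i).mono fun j hj => hu hj)
  have hle' {z w : α} (hz : MapClusterPt z atTop u) (hw : MapClusterPt w atTop u) : w ≤ z :=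
    isClosed_Ici.mem_of_mapClusterPt hz (Eventually.of_forall (hle hw))
  obtain ⟨a, -, ha⟩ := isCompact_Icc.exists_mapClusterPt_of_frequently hmem.frequently
  exact ⟨a, isCompact_Icc.tendsto_nhds_of_unique_mapClusterPt hmem
    fun z _ hz => (hle' ha hz).antisymm (hle' hz ha)⟩

end Order

section Spectrum

theorem tendsto_pow_zero_of_spectralRadius_lt_one {A : Type*} [NormedRing A] [NormedAlgebra ℂ A]
    [CompleteSpace A] {a : A} (ha : spectralRadius ℂ a < 1) :
    Tendsto (a ^ ·) atTop (𝓝 0) := by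
  obtain ⟨r, har, hr⟩ := ENNReal.lt_iff_exists_nnreal_btwn.1 ha
  have gelfand : ∀ᶠ k : ℕ in atTop, (‖a ^ k‖₊ : ENNReal) ^ (1 / k : ℝ) < r :=
    (spectrum.pow_nnnorm_pow_one_div_tendsto_nhds_spectralRadius a).eventually_lt_const har
  refine squeeze_zero_norm' (a := fun k => (r : ℝ) ^ k) ?_
    (tendsto_pow_atTop_nhds_zero_of_lt_one r.coe_nonneg (mod_cast hr))
  filter_upwards [gelfand, eventually_ne_atTop 0] with k hk hk0
  have h : (‖a ^ k‖₊ : ENNReal) ≤ r ^ k := by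
    rw [one_div, ENNReal.rpow_inv_lt_iff (by positivity), ENNReal.rpow_natCast] at hk
    exact hk.le
  exact_mod_cast h

variable {ι : Type*} [Fintype ι] [DecidableEq ι]

theorem mem_spectrum_iff_exists_mulVec_eq_smul {K : Type*} [Field K] {M : Matrix ι ι K} {z : K} :
    z ∈ spectrum K M ↔ ∃ v ≠ 0, M *ᵥ v = z • v := by
  rw [spectrum.mem_iff, isUnit_iff_isUnit_det, isUnit_iff_ne_zero, not_not,
    ← exists_mulVec_eq_zero_iff]
  simp only [sub_mulVec, Algebra.algebraMap_eq_smul_one, smul_mulVec, one_mulVec, sub_eq_zero,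
    eq_comm]

attribute [local instance] Matrix.linftyOpNormedRing Matrix.linftyOpNormedAlgebra in
theorem tendsto_pow_zero_of_forall_mem_spectrum_norm_lt_one {M : Matrix ι ι ℂ}
    (hM : ∀ z ∈ spectrum ℂ M, ‖z‖ < 1) : Tendsto (M ^ ·) atTop (𝓝 0) := by
  cases isEmpty_or_nonempty ι
  · exact tendsto_const_nhds.congr fun k => Subsingleton.elim 0 _
  · have : CompleteSpace (Matrix ι ι ℂ) := FiniteDimensional.complete ℂ _
    exact tendsto_pow_zero_of_spectralRadius_lt_one
      (mod_cast spectrum.spectralRadius_lt_of_forall_lt M (r := 1) hM)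

theorem tendsto_pow_zero_of_forall_mem_spectrum_map_norm_lt_one {M : Matrix ι ι ℝ}
    (hM : ∀ z ∈ spectrum ℂ (M.map (algebraMap ℝ ℂ)), ‖z‖ < 1) :
    Tendsto (M ^ ·) atTop (𝓝 0) := by
  have hre : Continuous fun N : Matrix ι ι ℂ => N.map Complex.re :=
    continuous_id.matrix_map Complex.continuous_re
  have hlim := (hre.tendsto 0).comp (tendsto_pow_zero_of_forall_mem_spectrum_norm_lt_one hM)
  have hpow (k : ℕ) : (M.map (algebraMap ℝ ℂ) ^ k).map Complex.re = M ^ k := by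
    rw [← RingHom.mapMatrix_apply, ← map_pow]
    ext
    simp
  simpa only [Function.comp_def, hpow, Matrix.map_zero, Complex.zero_re] using hlim

end Spectrum

section PosSemidef

open scoped ComplexOrder

variable {𝕜 ι κ : Type*} [RCLike 𝕜]

instance instOrderClosedTopologyMatrix [Finite ι] : OrderClosedTopology (Matrix ι ι 𝕜) where
  isClosed_le' := by
    cases nonempty_fintype ι
    simp only [Matrix.le_iff, posSemidef_iff_dotProduct_mulVec, IsHermitian, Set.ofPred_and,
      Set.ofPred_forall]
    exact (isClosed_eq (by fun_prop) (by fun_prop)).inter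
      (isClosed_iInter fun x => isClosed_le continuous_const (by fun_prop))

theorem norm_apply_le_of_nonneg [Finite ι] {X : Matrix ι ι 𝕜} (hX : 0 ≤ X) (i j : ι) :
    ‖X i j‖ ≤ (RCLike.re (X i i) + RCLike.re (X j j)) / 2 := by
  classical
  cases nonempty_fintype ι
  obtain ⟨C, rfl⟩ := CStarAlgebra.nonneg_iff_eq_star_mul_self.1 hX
  have hdiag (i : ι) : RCLike.re ((star C * C) i i) = ∑ k, ‖C k i‖ ^ 2 := by
    simp only [star_eq_conjTranspose, mul_apply, conjTranspose_apply, map_sum, RCLike.star_def,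
      RCLike.conj_mul, ← RCLike.ofReal_pow, RCLike.ofReal_re]
  rw [hdiag, hdiag, ← Finset.sum_add_distrib, Finset.sum_div]
  refine (norm_sum_le _ _).trans (Finset.sum_le_sum fun k _ => ?_)
  simp only [star_eq_conjTranspose, conjTranspose_apply, norm_mul, norm_star]
  linarith [two_mul_le_add_sq ‖C k i‖ ‖C k j‖]

instance instCompactIccSpaceMatrix [Finite ι] : CompactIccSpace (Matrix ι ι 𝕜) where
  isCompact_Icc {X Y} := by
    let r (i : ι) : ℝ := RCLike.re (Y i i - X i i)
    have hcompact := isCompact_univ_pi fun i => isCompact_univ_pi fun j =>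
      isCompact_closedBall (X i j) ((r i + r j) / 2)
    refine IsCompact.of_isClosed_subset (X := Matrix ι ι 𝕜) hcompact isClosed_Icc
      fun Z ⟨hXZ, hZY⟩ i _ j _ => ?_
    have hdiag (i : ι) : RCLike.re (Z i i - X i i) ≤ r i :=
      (RCLike.le_iff_re_im.1 (sub_le_sub_right (sub_nonneg.1 hZY.diag_nonneg) _)).1
    rw [mem_closedBall_iff_norm]
    refine (norm_apply_le_of_nonneg (sub_nonneg.2 hXZ) i j).trans ?_
    simp only [Matrix.sub_apply]
    linarith [hdiag i, hdiag j]

theorem eventually_nhds_posDef_of_isHermitian [Finite ι] {M : Matrix ι ι 𝕜} (hM : M.PosDef) :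
    ∀ᶠ N in 𝓝 M, N.IsHermitian → N.PosDef := by
  cases nonempty_fintype ι
  have hsphere : ∀ᶠ N in 𝓝 M, ∀ x ∈ Metric.sphere (0 : ι → 𝕜) 1,
      0 < RCLike.re (star x ⬝ᵥ N *ᵥ x) := by
    refine (isCompact_sphere _ _).eventually_forall_of_forall_eventually fun x hx => ?_
    have hc : Continuous fun p : Matrix ι ι 𝕜 × (ι → 𝕜) => RCLike.re (star p.2 ⬝ᵥ p.1 *ᵥ p.2) := by
      fun_prop
    exact hc.continuousAt.eventually_const_lt
      (hM.re_dotProduct_pos (ne_zero_of_mem_unit_sphere ⟨x, hx⟩))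
  filter_upwards [hsphere] with N hN hNH
  refine .of_dotProduct_mulVec_pos hNH fun x hx => ?_
  have hx' : 0 < (‖x‖⁻¹ : ℝ) := inv_pos.2 (norm_pos_iff.2 hx)
  have hpos := hN ((‖x‖⁻¹ : ℝ) • x) (by simp [norm_smul, hx])
  rw [star_smul, smul_dotProduct, mulVec_smul, dotProduct_smul, star_trivial, RCLike.smul_re,
    RCLike.smul_re, mul_pos_iff_of_pos_left hx', mul_pos_iff_of_pos_left hx'] at hpos
  exact RCLike.pos_iff.2 ⟨hpos, hNH.im_star_dotProduct_mulVec_self x⟩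

variable [Fintype ι] [Fintype κ]

theorem mulVec_eq_zero_of_nonneg_of_le {X Y : Matrix ι ι 𝕜} (hX : 0 ≤ X) (hXY : X ≤ Y)
    {v : ι → 𝕜} (hv : Y *ᵥ v = 0) : X *ᵥ v = 0 := by
  have hX' := nonneg_iff_posSemidef.1 hX
  refine (hX'.dotProduct_mulVec_zero_iff v).1 (le_antisymm ?_ (hX'.dotProduct_mulVec_nonneg v))
  simpa [sub_mulVec, hv] using PosSemidef.dotProduct_mulVec_nonneg hXY v

theorem conjTranspose_mul_mul_same_mulVec_eq_zero_iff {R : Matrix κ κ 𝕜} (hR : R.PosDef)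
    {C : Matrix κ ι 𝕜} {v : ι → 𝕜} : (Cᴴ * R * C) *ᵥ v = 0 ↔ C *ᵥ v = 0 := by
  refine ⟨fun h => ?_, fun h => by rw [← mulVec_mulVec, h, mulVec_zero]⟩
  by_contra hCv
  refine (hR.dotProduct_mulVec_pos hCv).ne' ?_
  rw [star_mulVec, ← dotProduct_mulVec, mulVec_mulVec, mulVec_mulVec, h,
    dotProduct_zero]

open scoped Classical in
theorem sqrt_mulVec_eq_zero_iff {Q : Matrix ι ι 𝕜} (hQ : 0 ≤ Q) {v : ι → 𝕜} :
    CFC.sqrt Q *ᵥ v = 0 ↔ Q *ᵥ v = 0 := by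
  have hQ' : Q = (CFC.sqrt Q)ᴴ * CFC.sqrt Q := by
    rw [(CFC.sqrt_nonneg Q).posSemidef.isHermitian.eq, CFC.sqrt_mul_sqrt_self Q]
  conv_rhs => rw [hQ']
  exact (conjTranspose_mul_self_mulVec_eq_zero _ v).symm

theorem nonneg_of_stein [DecidableEq ι] {M X : Matrix ι ι 𝕜} (hM : Tendsto (M ^ ·) atTop (𝓝 0))
    (h : Mᴴ * X * M ≤ X) : 0 ≤ X := by
  have hk (k : ℕ) : (M ^ k)ᴴ * X * M ^ k ≤ X := by
    induction k with
    | zero => simp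
    | succ k ih =>
      calc (M ^ (k + 1))ᴴ * X * M ^ (k + 1) = (M ^ k)ᴴ * (Mᴴ * X * M) * M ^ k := by
            rw [pow_succ', conjTranspose_mul]; noncomm_ring
        _ ≤ (M ^ k)ᴴ * X * M ^ k := star_left_conjugate_le_conjugate h _
        _ ≤ X := ih
  have hc : Continuous fun N : Matrix ι ι 𝕜 => Nᴴ * X * N := by fun_prop
  have hlim := (hc.tendsto 0).comp hM
  rw [mul_zero] at hlim
  exact le_of_tendsto' hlim hk

end PosSemidef

section Hurwitz

section QuadraticForm

variable {ι K : Type*} [Fintype ι] [CommRing K] {X : Matrix ι ι K}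

theorem dotProduct_mulVec_comm_of_isSymm (hX : X.IsSymm) (v w : ι → K) :
    v ⬝ᵥ X *ᵥ w = w ⬝ᵥ X *ᵥ v := by
  rw [← dotProduct_transpose_mulVec, hX.eq]

theorem dotProduct_lyapunov_mulVec (hX : X.IsSymm) (F : Matrix ι ι K) (v : ι → K) :
    v ⬝ᵥ (Fᵀ * X + X * F) *ᵥ v = 2 * (v ⬝ᵥ X *ᵥ F *ᵥ v) := by
  rw [add_mulVec, dotProduct_add, ← mulVec_mulVec, ← mulVec_mulVec,
    dotProduct_transpose_mulVec, dotProduct_comm, dotProduct_mulVec_comm_of_isSymm hX (F *ᵥ v),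
    two_mul]

end QuadraticForm

section Cayley

variable {ι K : Type*} [Fintype ι] [DecidableEq ι]

/-- The Cayley transform `(F + 1) (F - 1)⁻¹`. It maps the open left half plane to the open unit
disc, and so turns the Lyapunov equation of `F` into a Stein equation. The inverse is junk when
`F - 1` is singular. -/
noncomputable def cayley [CommRing K] (F : Matrix ι ι K) : Matrix ι ι K :=
  (F + 1) * (F - 1)⁻¹

theorem cayley_mul_sub_one [CommRing K] {F : Matrix ι ι K} (hF : IsUnit (F - 1)) :
    cayley F * (F - 1) = F + 1 :=
  nonsing_inv_mul_cancel_right _ _ ((isUnit_iff_isUnit_det _).1 hF)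

theorem sub_transpose_cayley_mul_mul_cayley [CommRing K] {F : Matrix ι ι K}
    (hF : IsUnit (F - 1)) (X : Matrix ι ι K) :
    X - (cayley F)ᵀ * X * cayley F =
      ((F - 1)⁻¹)ᵀ * (2 • -(Fᵀ * X + X * F)) * (F - 1)⁻¹ := by
  have hinv : (F - 1) * (F - 1)⁻¹ = 1 := mul_nonsing_inv _ ((isUnit_iff_isUnit_det _).1 hF)
  have hinvT : ((F - 1)⁻¹)ᵀ * (F - 1)ᵀ = 1 := by rw [← transpose_mul, hinv, transpose_one]
  calc X - (cayley F)ᵀ * X * cayley F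
      = ((F - 1)⁻¹)ᵀ * (F - 1)ᵀ * X * ((F - 1) * (F - 1)⁻¹) - (cayley F)ᵀ * X * cayley F := by
        rw [hinv, hinvT, one_mul, mul_one]
    _ = ((F - 1)⁻¹)ᵀ * ((F - 1)ᵀ * X * (F - 1) - (F + 1)ᵀ * X * (F + 1)) * (F - 1)⁻¹ := by
        rw [cayley, transpose_mul]
        noncomm_ring
    _ = ((F - 1)⁻¹)ᵀ * (2 • -(Fᵀ * X + X * F)) * (F - 1)⁻¹ := by
        congr 2
        simp only [transpose_sub, transpose_add, transpose_one]
        noncomm_ring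

theorem re_add_one_div_sub_one (z : ℂ) :
    ((z + 1) / (z - 1)).re = (‖z‖ ^ 2 - 1) / ‖z - 1‖ ^ 2 := by
  rw [Complex.div_re, Complex.sq_norm, Complex.sq_norm, ← add_div, Complex.normSq_apply z]
  simp only [Complex.add_re, Complex.sub_re, Complex.one_re, Complex.add_im, Complex.sub_im,
    Complex.one_im]
  ring

end Cayley

variable {n : ℕ} {F G X W : Matrix (Fin n) (Fin n) ℝ}

theorem isHurwitz_iff_forall_mulVec_eq_smul : IsHurwitz F ↔
    ∀ (z : ℂ) (v : Fin n → ℂ), v ≠ 0 → F.map (algebraMap ℝ ℂ) *ᵥ v = z • v → z.re < 0 := by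
  simp only [IsHurwitz, mem_spectrum_iff_exists_mulVec_eq_smul, forall_exists_index, and_imp]

theorem map_mulVec_eq_smul_iff {z : ℂ} {v : Fin n → ℂ} :
    F.map (algebraMap ℝ ℂ) *ᵥ v = z • v ↔
      F *ᵥ (Complex.re ∘ v) = z.re • (Complex.re ∘ v) - z.im • (Complex.im ∘ v) ∧
      F *ᵥ (Complex.im ∘ v) = z.re • (Complex.im ∘ v) + z.im • (Complex.re ∘ v) := by
  simp only [funext_iff, Complex.ext_iff, ← forall_and, mulVec, dotProduct, Complex.re_sum,
    Complex.im_sum]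
  simp

theorem IsHurwitz.isUnit_sub_one (hF : IsHurwitz F) : IsUnit (F - 1) := by
  rw [isUnit_iff_isUnit_det, isUnit_iff_ne_zero]
  intro h
  obtain ⟨v, hv, hFv⟩ := exists_mulVec_eq_zero_iff.2 h
  rw [sub_mulVec, one_mulVec, sub_eq_zero] at hFv
  have hv' : (Complex.ofReal ∘ v) ≠ 0 := fun h => hv (funext fun i => by simpa using congrFun h i)
  have hre := isHurwitz_iff_forall_mulVec_eq_smul.1 hF 1 _ hv'
    (map_mulVec_eq_smul_iff.2 (by simp [Function.comp_def, hFv, ← Pi.zero_def]))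
  exact absurd hre (by simp)

theorem IsHurwitz.norm_lt_one_of_mem_spectrum_cayley (hF : IsHurwitz F) {z : ℂ}
    (hz : z ∈ spectrum ℂ ((cayley F).map (algebraMap ℝ ℂ))) : ‖z‖ < 1 := by
  obtain ⟨v, hv, hzv⟩ := mem_spectrum_iff_exists_mulVec_eq_smul.1 hz
  let toComplex := (algebraMap ℝ ℂ).mapMatrix (m := Fin n)
  have hunit : IsUnit (toComplex F - 1) := by
    simpa only [map_sub, map_one] using hF.isUnit_sub_one.map toComplex
  have hmul : toComplex (cayley F) * (toComplex F - 1) = toComplex F + 1 := by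
    simpa only [map_mul, map_sub, map_add, map_one] using
      congrArg toComplex (cayley_mul_sub_one hF.isUnit_sub_one)
  obtain ⟨w, rfl⟩ := mulVec_surjective_iff_isUnit.2 hunit v
  have hw : w ≠ 0 := by
    rintro rfl
    exact hv (mulVec_zero _)
  replace hzv : toComplex F *ᵥ w + w = z • (toComplex F *ᵥ w) - z • w := by
    rw [← RingHom.mapMatrix_apply, mulVec_mulVec, hmul] at hzv
    simpa only [add_mulVec, sub_mulVec, one_mulVec, smul_sub] using hzv
  have hz1 : z - 1 ≠ 0 := by
    intro h
    obtain rfl := sub_eq_zero.1 h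
    exact hw (by linear_combination (norm := module) (1 / 2 : ℂ) • hzv)
  have hre := isHurwitz_iff_forall_mulVec_eq_smul.1 hF ((z + 1) / (z - 1)) w hw <| by
    rw [div_eq_inv_mul, mul_smul, eq_inv_smul_iff₀ hz1]
    change (z - 1) • (toComplex F *ᵥ w) = (z + 1) • w
    linear_combination (norm := module) (-1 : ℂ) • hzv
  rw [re_add_one_div_sub_one] at hre
  by_contra! hz_le
  exact hre.not_ge (div_nonneg (sub_nonneg.2 (one_le_pow₀ hz_le)) (sq_nonneg _))

theorem IsHurwitz.tendsto_cayley_pow (hF : IsHurwitz F) :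
    Tendsto (cayley F ^ ·) atTop (𝓝 0) :=
  tendsto_pow_zero_of_forall_mem_spectrum_map_norm_lt_one fun _ hz =>
    hF.norm_lt_one_of_mem_spectrum_cayley hz

theorem transpose_mul_mul_nonneg {ι κ : Type*} [Finite ι] [Fintype κ] {M : Matrix κ κ ℝ}
    (hM : 0 ≤ M) (C : Matrix κ ι ℝ) : 0 ≤ Cᵀ * M * C := by
  cases nonempty_fintype ι
  rw [← conjTranspose_eq_transpose_of_trivial]
  exact ((nonneg_iff_posSemidef.1 hM).conjTranspose_mul_mul_same C).nonneg

theorem IsHurwitz.nonneg_of_lyapunov (hF : IsHurwitz F) (h : Fᵀ * X + X * F ≤ 0) : 0 ≤ X := by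
  refine nonneg_of_stein hF.tendsto_cayley_pow (sub_nonneg.1 ?_)
  rw [conjTranspose_eq_transpose_of_trivial,
    sub_transpose_cayley_mul_mul_cayley hF.isUnit_sub_one]
  exact transpose_mul_mul_nonneg (nsmul_nonneg (neg_nonneg.2 h) 2) _

theorem IsHurwitz.le_of_lyapunov_le {Y : Matrix (Fin n) (Fin n) ℝ} (hF : IsHurwitz F)
    (h : Fᵀ * Y + Y * F ≤ Fᵀ * X + X * F) : X ≤ Y := by
  refine sub_nonneg.1 (hF.nonneg_of_lyapunov ?_)
  rw [mul_sub, sub_mul, sub_add_sub_comm]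
  exact sub_nonpos.2 h

theorem IsHurwitz.exists_lyapunov_eq (hF : IsHurwitz F) (W : Matrix (Fin n) (Fin n) ℝ) :
    ∃ X, Fᵀ * X + X * F = W := by
  let lyapunov := LinearMap.mulLeft ℝ Fᵀ + LinearMap.mulRight ℝ F
  have hinj : Function.Injective lyapunov := fun X Y h =>
    (hF.le_of_lyapunov_le (ge_of_eq h)).antisymm (hF.le_of_lyapunov_le (le_of_eq h))
  exact LinearMap.surjective_of_injective hinj W

theorem isHurwitz_of_lyapunov (hX : 0 ≤ X) (hW : 0 ≤ W) (h : Fᵀ * X + X * F + W ≤ 0)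
    (hG : IsHurwitz G) (hFG : ∀ v, W *ᵥ v = 0 → F *ᵥ v = G *ᵥ v) : IsHurwitz F := by
  have hX' := nonneg_iff_posSemidef.1 hX
  have hW' := nonneg_iff_posSemidef.1 hW
  have hXs : X.IsSymm := isHermitian_iff_isSymm.1 hX'.isHermitian
  have hdecrease (v : Fin n → ℝ) : 2 * (v ⬝ᵥ X *ᵥ (F *ᵥ v)) + v ⬝ᵥ W *ᵥ v ≤ 0 := by
    have hv := (nonneg_iff_posSemidef.1 (neg_nonneg.2 h)).dotProduct_mulVec_nonneg v
    rwa [star_trivial, neg_mulVec, dotProduct_neg, Left.nonneg_neg_iff, add_mulVec, dotProduct_add,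
      dotProduct_lyapunov_mulVec hXs] at hv
  rw [isHurwitz_iff_forall_mulVec_eq_smul] at hG ⊢
  intro z v hv hFv
  obtain ⟨hre, him⟩ := map_mulVec_eq_smul_iff.1 hFv
  by_contra! hz
  have hXW (u : Fin n → ℝ) : 0 ≤ z.re * (u ⬝ᵥ X *ᵥ u) ∧ 0 ≤ u ⬝ᵥ W *ᵥ u :=
    ⟨mul_nonneg hz (hX'.dotProduct_mulVec_nonneg u), hW'.dotProduct_mulVec_nonneg u⟩
  -- Summed over `Re v` and `Im v`, the cross terms proportional to `z.im` cancel.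
  have hre_le := hdecrease (Complex.re ∘ v)
  have him_le := hdecrease (Complex.im ∘ v)
  rw [hre, mulVec_sub, mulVec_smul, mulVec_smul, dotProduct_sub, dotProduct_smul, dotProduct_smul,
    smul_eq_mul, smul_eq_mul] at hre_le
  rw [him, mulVec_add, mulVec_smul, mulVec_smul, dotProduct_add, dotProduct_smul, dotProduct_smul,
    smul_eq_mul, smul_eq_mul,
    dotProduct_mulVec_comm_of_isSymm hXs (Complex.im ∘ v) (Complex.re ∘ v)] at him_le
  have hWre : W *ᵥ (Complex.re ∘ v) = 0 := (hW'.dotProduct_mulVec_zero_iff _).1 <| by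
    rw [star_trivial]
    linarith [hXW (Complex.re ∘ v), hXW (Complex.im ∘ v)]
  have hWim : W *ᵥ (Complex.im ∘ v) = 0 := (hW'.dotProduct_mulVec_zero_iff _).1 <| by
    rw [star_trivial]
    linarith [hXW (Complex.re ∘ v), hXW (Complex.im ∘ v)]
  have hGv := map_mulVec_eq_smul_iff.2 ⟨hFG _ hWre ▸ hre, hFG _ hWim ▸ him⟩
  exact (hG z v hv hGv).not_ge hz

end Hurwitz

section Riccati

variable {n m : ℕ} {A : Matrix (Fin n) (Fin n) ℝ} {B : Matrix (Fin n) (Fin m) ℝ}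
  {Q X Y : Matrix (Fin n) (Fin n) ℝ} {R : Matrix (Fin m) (Fin m) ℝ}
  {K : Matrix (Fin m) (Fin n) ℝ}

/-- The gain `R⁻¹ Bᵀ X` attached to a candidate cost matrix `X`: the feedback that policy
iteration selects after `X`, and the optimal one when `X` is the stabilizing Riccati solution. -/
noncomputable def feedbackGain (B : Matrix (Fin n) (Fin m) ℝ) (R : Matrix (Fin m) (Fin m) ℝ)
    (X : Matrix (Fin n) (Fin n) ℝ) : Matrix (Fin m) (Fin n) ℝ :=
  R⁻¹ * Bᵀ * X

/-- The left-hand side `(A - B K)ᵀ X + X (A - B K) + Q + Kᵀ R K` of the Lyapunov equation whose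
solution is the cost matrix of the feedback `u = -K x`. -/
def costResidual (A : Matrix (Fin n) (Fin n) ℝ) (B : Matrix (Fin n) (Fin m) ℝ)
    (Q : Matrix (Fin n) (Fin n) ℝ) (R : Matrix (Fin m) (Fin m) ℝ)
    (K : Matrix (Fin m) (Fin n) ℝ) (X : Matrix (Fin n) (Fin n) ℝ) : Matrix (Fin n) (Fin n) ℝ :=
  (A - B * K)ᵀ * X + X * (A - B * K) + (Q + Kᵀ * R * K)

theorem isSymm_of_nonneg {ι : Type*} {M : Matrix ι ι ℝ} (hM : 0 ≤ M) : M.IsSymm :=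
  isHermitian_iff_isSymm.1 (nonneg_iff_posSemidef.1 hM).isHermitian

theorem costResidual_eq_riccati_add (hRu : IsUnit R) (hR : R.IsSymm) (hX : X.IsSymm)
    (K : Matrix (Fin m) (Fin n) ℝ) :
    costResidual A B Q R K X = (Aᵀ * X + X * A - X * B * R⁻¹ * Bᵀ * X + Q) +
      (K - feedbackGain B R X)ᵀ * R * (K - feedbackGain B R X) := by
  have hgain : R * feedbackGain B R X = Bᵀ * X := by
    rw [feedbackGain, Matrix.mul_assoc,
      mul_nonsing_inv_cancel_left _ _ ((isUnit_iff_isUnit_det R).1 hRu)]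
  have hgainT : (feedbackGain B R X)ᵀ * R = X * B := by
    simpa only [transpose_mul, transpose_transpose, hR.eq, hX.eq] using congrArg transpose hgain
  have hsquare : (K - feedbackGain B R X)ᵀ * R * (K - feedbackGain B R X) =
      Kᵀ * R * K - X * B * K - Kᵀ * (Bᵀ * X) + X * B * feedbackGain B R X := by
    rw [transpose_sub, Matrix.sub_mul, Matrix.sub_mul, Matrix.mul_sub, Matrix.mul_sub, hgainT,
      Matrix.mul_assoc Kᵀ R (feedbackGain B R X), hgain]
    abel
  rw [hsquare, costResidual, feedbackGain, transpose_sub, transpose_mul]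
  simp only [Matrix.sub_mul, Matrix.mul_sub, Matrix.mul_assoc]
  abel

theorem costResidual_feedbackGain (hRu : IsUnit R) (hR : R.IsSymm) (hX : X.IsSymm) :
    costResidual A B Q R (feedbackGain B R X) X =
      Aᵀ * X + X * A - X * B * R⁻¹ * Bᵀ * X + Q := by
  rw [costResidual_eq_riccati_add hRu hR hX, sub_self, Matrix.mul_zero, add_zero]

theorem solvesCARE_iff_costResidual_feedbackGain (hRu : IsUnit R) (hR : R.IsSymm)
    (hX : X.IsSymm) : SolvesCARE A B Q R X ↔ costResidual A B Q R (feedbackGain B R X) X = 0 := by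
  rw [costResidual_feedbackGain hRu hR hX, SolvesCARE]

theorem costResidual_eq_add (hRu : IsUnit R) (hR : R.IsSymm) (hX : X.IsSymm)
    (K : Matrix (Fin m) (Fin n) ℝ) :
    costResidual A B Q R K X = costResidual A B Q R (feedbackGain B R X) X +
      (K - feedbackGain B R X)ᵀ * R * (K - feedbackGain B R X) := by
  rw [costResidual_feedbackGain hRu hR hX, costResidual_eq_riccati_add hRu hR hX]

theorem IsHurwitz.le_of_costResidual_le (hK : IsHurwitz (A - B * K))
    (h : costResidual A B Q R K Y ≤ costResidual A B Q R K X) : X ≤ Y :=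
  hK.le_of_lyapunov_le (le_of_add_le_add_right h)

theorem IsHurwitz.exists_costResidual_eq (hK : IsHurwitz (A - B * K))
    (Q : Matrix (Fin n) (Fin n) ℝ) (R : Matrix (Fin m) (Fin m) ℝ) (W : Matrix (Fin n) (Fin n) ℝ) :
    ∃ X, costResidual A B Q R K X = W :=
  (hK.exists_lyapunov_eq (W - (Q + Kᵀ * R * K))).imp fun _ hX => eq_sub_iff_add_eq.1 hX

theorem IsHurwitz.nonneg_of_costResidual_nonpos (hK : IsHurwitz (A - B * K)) (hQ : 0 ≤ Q)
    (hR : 0 ≤ R) (hX : costResidual A B Q R K X ≤ 0) : 0 ≤ X :=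
  hK.nonneg_of_lyapunov <| (le_add_of_nonneg_right
    (add_nonneg hQ (transpose_mul_mul_nonneg hR K))).trans hX

theorem SolvesCARE.costResidual_nonneg (h : SolvesCARE A B Q R X) (hR : R.PosDef)
    (hX : X.IsSymm) (K : Matrix (Fin m) (Fin n) ℝ) : 0 ≤ costResidual A B Q R K X := by
  rw [costResidual_eq_riccati_add hR.isUnit (isHermitian_iff_isSymm.1 hR.isHermitian) hX,
    h, zero_add]
  exact transpose_mul_mul_nonneg hR.posSemidef.nonneg _

theorem SolvesCARE.le_of_costResidual_nonpos (h : SolvesCARE A B Q R X) (hR : R.PosDef)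
    (hX : X.IsSymm) (hK : IsHurwitz (A - B * K)) (hY : costResidual A B Q R K Y ≤ 0) : X ≤ Y :=
  hK.le_of_costResidual_le (hY.trans (h.costResidual_nonneg hR hX K))

theorem isHurwitz_of_costResidual_add_nonpos (hQ : 0 ≤ Q) (hR : R.PosDef) (hX : 0 ≤ X)
    {G W : Matrix (Fin n) (Fin n) ℝ} (hG : IsHurwitz G) (hW : 0 ≤ W)
    (h : costResidual A B Q R K X + W ≤ 0)
    (hFG : ∀ v, Q *ᵥ v = 0 → K *ᵥ v = 0 → W *ᵥ v = 0 → (A - B * K) *ᵥ v = G *ᵥ v) :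
    IsHurwitz (A - B * K) := by
  have hKRK := transpose_mul_mul_nonneg hR.posSemidef.nonneg K
  refine isHurwitz_of_lyapunov hX (add_nonneg (add_nonneg hQ hKRK) hW)
    (by rwa [← add_assoc]) hG fun v hv => ?_
  have hker {M : Matrix (Fin n) (Fin n) ℝ} (hM : 0 ≤ M) (hle : M ≤ Q + Kᵀ * R * K + W) :
      M *ᵥ v = 0 := mulVec_eq_zero_of_nonneg_of_le hM hle hv
  have hKv := hker hKRK ((le_add_of_nonneg_left hQ).trans (le_add_of_nonneg_right hW))
  rw [← conjTranspose_eq_transpose_of_trivial,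
    conjTranspose_mul_mul_same_mulVec_eq_zero_iff hR] at hKv
  exact hFG v (hker hQ ((le_add_of_nonneg_right hKRK).trans (le_add_of_nonneg_right hW))) hKv
    (hker hW (le_add_of_nonneg_left (add_nonneg hQ hKRK)))

section Limits

variable {α : Type*} {l : Filter α} {A' Q' P' : α → Matrix (Fin n) (Fin n) ℝ}
  {B' : α → Matrix (Fin n) (Fin m) ℝ} {R' : α → Matrix (Fin m) (Fin m) ℝ}
  {P : Matrix (Fin n) (Fin n) ℝ}

theorem tendsto_inv_of_isUnit {ι : Type*} [Fintype ι] [DecidableEq ι] {M : Matrix ι ι ℝ}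
    {M' : α → Matrix ι ι ℝ} (hM : IsUnit M) (h : Tendsto M' l (𝓝 M)) :
    Tendsto (fun i => (M' i)⁻¹) l (𝓝 M⁻¹) := by
  obtain ⟨u, hu⟩ := (isUnit_iff_isUnit_det M).1 hM
  exact (continuousAt_matrix_inv M (hu ▸ NormedRing.inverse_continuousAt u)).tendsto.comp h

theorem tendsto_matrix_mul {ι κ τ : Type*} [Fintype κ] {M : Matrix ι κ ℝ} {N : Matrix κ τ ℝ}
    {M' : α → Matrix ι κ ℝ} {N' : α → Matrix κ τ ℝ} (hM : Tendsto M' l (𝓝 M))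
    (hN : Tendsto N' l (𝓝 N)) : Tendsto (fun i => M' i * N' i) l (𝓝 (M * N)) :=
  ((continuous_fst.matrix_mul continuous_snd).tendsto (M, N)).comp (hM.prodMk_nhds hN)

theorem tendsto_matrix_transpose {ι κ : Type*} {M : Matrix ι κ ℝ} {M' : α → Matrix ι κ ℝ}
    (hM : Tendsto M' l (𝓝 M)) : Tendsto (fun i => (M' i)ᵀ) l (𝓝 Mᵀ) :=
  (continuous_id.matrix_transpose.tendsto M).comp hM

theorem tendsto_feedbackGain (hR : IsUnit R) (hB' : Tendsto B' l (𝓝 B))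
    (hR' : Tendsto R' l (𝓝 R)) (hP' : Tendsto P' l (𝓝 P)) :
    Tendsto (fun i => feedbackGain (B' i) (R' i) (P' i)) l (𝓝 (feedbackGain B R P)) :=
  tendsto_matrix_mul
    (tendsto_matrix_mul (tendsto_inv_of_isUnit hR hR') (tendsto_matrix_transpose hB')) hP'

theorem tendsto_costResidual {K' : α → Matrix (Fin m) (Fin n) ℝ} (hA' : Tendsto A' l (𝓝 A))
    (hB' : Tendsto B' l (𝓝 B)) (hQ' : Tendsto Q' l (𝓝 Q)) (hR' : Tendsto R' l (𝓝 R))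
    (hK' : Tendsto K' l (𝓝 K)) (hP' : Tendsto P' l (𝓝 P)) :
    Tendsto (fun i => costResidual (A' i) (B' i) (Q' i) (R' i) (K' i) (P' i)) l
      (𝓝 (costResidual A B Q R K P)) := by
  have hABK : Tendsto (fun i => A' i - B' i * K' i) l (𝓝 (A - B * K)) :=
    hA'.sub (tendsto_matrix_mul hB' hK')
  have hKRK : Tendsto (fun i => (K' i)ᵀ * R' i * K' i) l (𝓝 (Kᵀ * R * K)) :=
    tendsto_matrix_mul (tendsto_matrix_mul (tendsto_matrix_transpose hK') hR') hK'
  exact ((tendsto_matrix_mul (tendsto_matrix_transpose hABK) hP').add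
    (tendsto_matrix_mul hP' hABK)).add (hQ'.add hKRK)

end Limits

section PolicyIteration

/-- `P` is the cost matrix of some stabilizing feedback gain. -/
def IsStabilizingCost (A : Matrix (Fin n) (Fin n) ℝ) (B : Matrix (Fin n) (Fin m) ℝ)
    (Q : Matrix (Fin n) (Fin n) ℝ) (R : Matrix (Fin m) (Fin m) ℝ)
    (P : Matrix (Fin n) (Fin n) ℝ) : Prop :=
  ∃ K : Matrix (Fin m) (Fin n) ℝ, IsHurwitz (A - B * K) ∧ costResidual A B Q R K P = 0

variable {P : Matrix (Fin n) (Fin n) ℝ}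

theorem Stabilizable.exists_isStabilizingCost (h : Stabilizable A B)
    (Q : Matrix (Fin n) (Fin n) ℝ) (R : Matrix (Fin m) (Fin m) ℝ) :
    ∃ P, IsStabilizingCost A B Q R P := by
  obtain ⟨K, hK⟩ := h
  obtain ⟨P, hP⟩ := hK.exists_costResidual_eq Q R 0
  exact ⟨P, K, hK, hP⟩

theorem IsStabilizingCost.nonneg (h : IsStabilizingCost A B Q R P) (hQ : 0 ≤ Q) (hR : 0 ≤ R) :
    0 ≤ P := by
  obtain ⟨K, hK, hP⟩ := h
  exact hK.nonneg_of_costResidual_nonpos hQ hR hP.le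

theorem IsStabilizingCost.isHurwitz_sub_mul_feedbackGain (h : IsStabilizingCost A B Q R P)
    (hQ : 0 ≤ Q) (hR : R.PosDef) : IsHurwitz (A - B * feedbackGain B R P) := by
  have hP := h.nonneg hQ hR.posSemidef.nonneg
  obtain ⟨K, hK, hKP⟩ := h
  let D := K - feedbackGain B R P
  refine isHurwitz_of_costResidual_add_nonpos hQ hR hP hK
    (transpose_mul_mul_nonneg hR.posSemidef.nonneg D) ?_ fun v _ _ hv => ?_
  · rw [← costResidual_eq_add hR.isUnit (isHermitian_iff_isSymm.1 hR.isHermitian)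
      (isSymm_of_nonneg hP), hKP]
  · rw [← conjTranspose_eq_transpose_of_trivial,
      conjTranspose_mul_mul_same_mulVec_eq_zero_iff hR, sub_mulVec, sub_eq_zero] at hv
    rw [sub_mulVec, sub_mulVec, ← mulVec_mulVec, ← mulVec_mulVec, hv]

theorem IsStabilizingCost.exists_policy_improvement (h : IsStabilizingCost A B Q R P)
    (hQ : 0 ≤ Q) (hR : R.PosDef) :
    ∃ P' ≤ P, IsStabilizingCost A B Q R P' ∧
      costResidual A B Q R (feedbackGain B R P) P' = 0 := by
  have hF := h.isHurwitz_sub_mul_feedbackGain hQ hR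
  have hP := isSymm_of_nonneg (h.nonneg hQ hR.posSemidef.nonneg)
  obtain ⟨P', hP'⟩ := hF.exists_costResidual_eq Q R 0
  obtain ⟨K, -, hKP⟩ := h
  refine ⟨P', hF.le_of_costResidual_le (Q := Q) (R := R) ?_, ⟨_, hF, hP'⟩, hP'⟩
  rw [hP', ← hKP, costResidual_eq_add hR.isUnit (isHermitian_iff_isSymm.1 hR.isHermitian) hP K]
  exact le_add_of_nonneg_right (transpose_mul_mul_nonneg hR.posSemidef.nonneg _)

theorem Stabilizable.exists_policy_iteration (h : Stabilizable A B) (hQ : 0 ≤ Q)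
    (hR : R.PosDef) :
    ∃ P : ℕ → Matrix (Fin n) (Fin n) ℝ, Antitone P ∧ (∀ k, 0 ≤ P k) ∧
      ∀ k, costResidual A B Q R (feedbackGain B R (P k)) (P (k + 1)) = 0 := by
  obtain ⟨P₀, hP₀⟩ := h.exists_isStabilizingCost Q R
  choose! improve himprove using fun P (hP : IsStabilizingCost A B Q R P) =>
    hP.exists_policy_improvement hQ hR
  let P (k : ℕ) := improve^[k] P₀
  have hsucc (k : ℕ) : P (k + 1) = improve (P k) := Function.iterate_succ_apply' _ _ _
  have hP (k : ℕ) : IsStabilizingCost A B Q R (P k) := by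
    induction k with
    | zero => exact hP₀
    | succ k ih => exact hsucc k ▸ (himprove _ ih).2.1
  exact ⟨P, antitone_nat_of_succ_le fun k => hsucc k ▸ (himprove _ (hP k)).1,
    fun k => (hP k).nonneg hQ hR.posSemidef.nonneg, fun k => hsucc k ▸ (himprove _ (hP k)).2.2⟩

theorem Stabilizable.exists_solvesCARE (h : Stabilizable A B) (hQ : 0 ≤ Q) (hR : R.PosDef) :
    ∃ P, 0 ≤ P ∧ SolvesCARE A B Q R P := by
  obtain ⟨P, hanti, hnonneg, hres⟩ := h.exists_policy_iteration hQ hR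
  obtain ⟨L, hL⟩ := exists_tendsto_of_antitone hanti ⟨0, Set.forall_mem_range.2 hnonneg⟩
  have hL0 : 0 ≤ L := ge_of_tendsto' hL hnonneg
  refine ⟨L, hL0, (solvesCARE_iff_costResidual_feedbackGain hR.isUnit
    (isHermitian_iff_isSymm.1 hR.isHermitian) (isSymm_of_nonneg hL0)).2 ?_⟩
  have hlim := tendsto_costResidual (tendsto_const_nhds (x := A)) (tendsto_const_nhds (x := B))
    (tendsto_const_nhds (x := Q)) (tendsto_const_nhds (x := R))
    (tendsto_feedbackGain hR.isUnit (tendsto_const_nhds (x := B)) tendsto_const_nhds hL)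
    ((tendsto_add_atTop_iff_nat 1).2 hL)
  exact tendsto_nhds_unique hlim (tendsto_const_nhds.congr fun k => (hres k).symm)

end PolicyIteration

section Detectable

variable {P : Matrix (Fin n) (Fin n) ℝ}

theorem Detectable.isHurwitz_sub_mul_feedbackGain (hdet : Detectable A (CFC.sqrt Q))
    (hQ : 0 ≤ Q) (hR : R.PosDef) (hP : 0 ≤ P) (h : SolvesCARE A B Q R P) :
    IsHurwitz (A - B * feedbackGain B R P) := by
  obtain ⟨L, hL⟩ := hdet
  rw [solvesCARE_iff_costResidual_feedbackGain hR.isUnit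
    (isHermitian_iff_isSymm.1 hR.isHermitian) (isSymm_of_nonneg hP)] at h
  refine isHurwitz_of_costResidual_add_nonpos hQ hR hP hL le_rfl (by rw [h, add_zero])
    fun v hQv hKv _ => ?_
  rw [sub_mulVec, sub_mulVec, ← mulVec_mulVec, ← mulVec_mulVec, hKv,
    (sqrt_mulVec_eq_zero_iff hQ).2 hQv, mulVec_zero, mulVec_zero]

theorem Detectable.le_of_solvesCARE (hdet : Detectable A (CFC.sqrt Q)) (hQ : 0 ≤ Q)
    (hR : R.PosDef) (hP : 0 ≤ P) (h : SolvesCARE A B Q R P) (hX : X.IsSymm)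
    (hXC : SolvesCARE A B Q R X) : X ≤ P :=
  hXC.le_of_costResidual_nonpos hR hX (hdet.isHurwitz_sub_mul_feedbackGain hQ hR hP h)
    ((solvesCARE_iff_costResidual_feedbackGain hR.isUnit
      (isHermitian_iff_isSymm.1 hR.isHermitian) (isSymm_of_nonneg hP)).1 h).le

theorem Detectable.eq_of_solvesCARE (hdet : Detectable A (CFC.sqrt Q)) (hQ : 0 ≤ Q)
    (hR : R.PosDef) (hP : 0 ≤ P) (h : SolvesCARE A B Q R P) (hX : 0 ≤ X)
    (hXC : SolvesCARE A B Q R X) : X = P :=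
  (hdet.le_of_solvesCARE hQ hR hP h (isSymm_of_nonneg hX) hXC).antisymm
    (hdet.le_of_solvesCARE hQ hR hX hXC (isSymm_of_nonneg hP) h)

end Detectable

section Continuity

variable {α : Type*} {l : Filter α} {A' Q' P' : α → Matrix (Fin n) (Fin n) ℝ}
  {B' : α → Matrix (Fin n) (Fin m) ℝ} {R' : α → Matrix (Fin m) (Fin m) ℝ}
  {P : Matrix (Fin n) (Fin n) ℝ}

theorem costResidual_isSymm (hQ : Q.IsSymm) (hR : R.IsSymm) (hX : X.IsSymm) :
    (costResidual A B Q R K X).IsSymm := by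
  rw [IsSymm, costResidual]
  simp only [transpose_add, transpose_mul, transpose_transpose, hQ.eq, hR.eq, hX.eq,
    Matrix.mul_assoc, add_comm (X * _)]

theorem solvesCARE_of_tendsto [l.NeBot] (hR : R.PosDef) (hA' : Tendsto A' l (𝓝 A))
    (hB' : Tendsto B' l (𝓝 B)) (hQ' : Tendsto Q' l (𝓝 Q)) (hR' : Tendsto R' l (𝓝 R))
    (hP' : Tendsto P' l (𝓝 P)) (hR'pos : ∀ᶠ i in l, (R' i).PosDef)
    (hP'nonneg : ∀ᶠ i in l, 0 ≤ P' i)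
    (h : ∀ᶠ i in l, SolvesCARE (A' i) (B' i) (Q' i) (R' i) (P' i)) : SolvesCARE A B Q R P := by
  have hP : P.IsSymm := isSymm_of_nonneg (ge_of_tendsto hP' hP'nonneg)
  rw [solvesCARE_iff_costResidual_feedbackGain hR.isUnit
    (isHermitian_iff_isSymm.1 hR.isHermitian) hP]
  refine tendsto_nhds_unique (tendsto_costResidual hA' hB' hQ' hR'
    (tendsto_feedbackGain hR.isUnit hB' hR' hP') hP') (tendsto_const_nhds.congr' ?_)
  filter_upwards [hR'pos, hP'nonneg, h] with i hRi hPi hi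
  exact ((solvesCARE_iff_costResidual_feedbackGain hRi.isUnit
    (isHermitian_iff_isSymm.1 hRi.isHermitian) (isSymm_of_nonneg hPi)).1 hi).symm

theorem Stabilizable.exists_eventually_le_of_solvesCARE (hst : Stabilizable A B) (hQ : 0 ≤ Q)
    (hR : 0 ≤ R) (hA' : Tendsto A' l (𝓝 A)) (hB' : Tendsto B' l (𝓝 B))
    (hQ' : Tendsto Q' l (𝓝 Q)) (hR' : Tendsto R' l (𝓝 R)) (hQ'nonneg : ∀ᶠ i in l, 0 ≤ Q' i)
    (hR'pos : ∀ᶠ i in l, (R' i).PosDef) :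
    ∃ Y, ∀ᶠ i in l, ∀ X : Matrix (Fin n) (Fin n) ℝ, X.IsSymm →
      SolvesCARE (A' i) (B' i) (Q' i) (R' i) X → X ≤ Y := by
  obtain ⟨K, hK⟩ := hst
  obtain ⟨Y, hY⟩ := hK.exists_costResidual_eq Q R (-1)
  have hY0 : 0 ≤ Y := hK.nonneg_of_costResidual_nonpos hQ hR <| by
    rw [hY]
    exact neg_nonpos.2 PosSemidef.one.nonneg
  let W (i : α) := -costResidual (A' i) (B' i) (Q' i) (R' i) K Y
  have hW : Tendsto W l (𝓝 1) := by
    have hlim := (tendsto_costResidual hA' hB' hQ' hR' (tendsto_const_nhds (x := K))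
      (tendsto_const_nhds (x := Y))).neg
    rwa [hY, neg_neg] at hlim
  refine ⟨Y, ?_⟩
  filter_upwards [hQ'nonneg, hR'pos, hW (eventually_nhds_posDef_of_isHermitian PosDef.one)]
    with i hQi hRi hWi X hX hXC
  have hWpos : (W i).PosDef := hWi <| isHermitian_iff_isSymm.2 <| (costResidual_isSymm
    (isSymm_of_nonneg hQi) (isHermitian_iff_isSymm.1 hRi.isHermitian) (isSymm_of_nonneg hY0)).neg
  refine hXC.le_of_costResidual_nonpos hRi hX (isHurwitz_of_costResidual_add_nonpos hQi hRi hY0 hK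
    hWpos.posSemidef.nonneg (add_neg_cancel _).le fun v _ _ hv => ?_)
    (neg_nonneg.1 hWpos.posSemidef.nonneg)
  obtain rfl : v = 0 := mulVec_injective_of_isUnit hWpos.isUnit (hv.trans (mulVec_zero _).symm)
  rw [mulVec_zero, mulVec_zero]

theorem tendsto_of_solvesCARE (hst : Stabilizable A B) (hdet : Detectable A (CFC.sqrt Q))
    (hQ : 0 ≤ Q) (hR : R.PosDef) (hP : 0 ≤ P) (h : SolvesCARE A B Q R P)
    (hA' : Tendsto A' l (𝓝 A)) (hB' : Tendsto B' l (𝓝 B)) (hQ' : Tendsto Q' l (𝓝 Q))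
    (hR' : Tendsto R' l (𝓝 R)) (hQ'nonneg : ∀ᶠ i in l, 0 ≤ Q' i)
    (hR'pos : ∀ᶠ i in l, (R' i).PosDef) (hP'nonneg : ∀ᶠ i in l, 0 ≤ P' i)
    (h' : ∀ᶠ i in l, SolvesCARE (A' i) (B' i) (Q' i) (R' i) (P' i)) : Tendsto P' l (𝓝 P) := by
  obtain ⟨Y, hY⟩ := hst.exists_eventually_le_of_solvesCARE hQ hR.posSemidef.nonneg hA' hB' hQ' hR'
    hQ'nonneg hR'pos
  have hmem : ∀ᶠ i in l, P' i ∈ Set.Icc 0 Y := by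
    filter_upwards [hY, hP'nonneg, h'] with i hi hPi hCi
    exact ⟨hPi, hi _ (isSymm_of_nonneg hPi) hCi⟩
  refine isCompact_Icc.tendsto_nhds_of_unique_mapClusterPt hmem fun Z hZ hcluster => ?_
  obtain ⟨U, hU, hUZ⟩ := mapClusterPt_iff_ultrafilter.1 hcluster
  exact hdet.eq_of_solvesCARE hQ hR hP h hZ.1 <| solvesCARE_of_tendsto hR (hA'.mono_left hU)
    (hB'.mono_left hU) (hQ'.mono_left hU) (hR'.mono_left hU) hUZ (hU hR'pos) (hU hP'nonneg) (hU h')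

end Continuity

section CareSolution

theorem Stabilizable.careSolution_nonneg_and_solvesCARE (hst : Stabilizable A B) (hQ : 0 ≤ Q)
    (hR : R.PosDef) :
    0 ≤ careSolution A B Q R ∧ SolvesCARE A B Q R (careSolution A B Q R) := by
  have h : ∃ P : Matrix (Fin n) (Fin n) ℝ, P.PosSemidef ∧ SolvesCARE A B Q R P := by
    simpa only [nonneg_iff_posSemidef] using hst.exists_solvesCARE hQ hR
  rw [careSolution, dif_pos h, nonneg_iff_posSemidef]
  exact h.choose_spec

theorem continuousOn_optimalGain {α : Type*} [TopologicalSpace α] {S : Set α}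
    {A Q : α → Matrix (Fin n) (Fin n) ℝ} {B : α → Matrix (Fin n) (Fin m) ℝ}
    {R : α → Matrix (Fin m) (Fin m) ℝ} (hA : ContinuousOn A S) (hB : ContinuousOn B S)
    (hQ : ContinuousOn Q S) (hR : ContinuousOn R S) (hQnonneg : ∀ ρ ∈ S, 0 ≤ Q ρ)
    (hRpos : ∀ ρ ∈ S, (R ρ).PosDef) (hst : ∀ ρ ∈ S, Stabilizable (A ρ) (B ρ))
    (hdet : ∀ ρ ∈ S, Detectable (A ρ) (CFC.sqrt (Q ρ))) :
    ContinuousOn (fun ρ => optimalGain (A ρ) (B ρ) (Q ρ) (R ρ)) S := by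
  intro ρ hρ
  have hP (σ : α) (hσ : σ ∈ S) :=
    (hst σ hσ).careSolution_nonneg_and_solvesCARE (hQnonneg σ hσ) (hRpos σ hσ)
  refine tendsto_feedbackGain (hRpos ρ hρ).isUnit (hB ρ hρ) (hR ρ hρ) ?_
  exact tendsto_of_solvesCARE (hst ρ hρ) (hdet ρ hρ) (hQnonneg ρ hρ) (hRpos ρ hρ) (hP ρ hρ).1
    (hP ρ hρ).2 (hA ρ hρ) (hB ρ hρ) (hQ ρ hρ) (hR ρ hρ)
    (eventually_mem_nhdsWithin.mono hQnonneg) (eventually_mem_nhdsWithin.mono hRpos)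
    (eventually_mem_nhdsWithin.mono fun σ hσ => (hP σ hσ).1)
    (eventually_mem_nhdsWithin.mono fun σ hσ => (hP σ hσ).2)

end CareSolution

end Riccati

theorem continuous_systemMatrix {n p : ℕ} (A₀ : Matrix (Fin n) (Fin n) ℝ)
    (A₁ : Fin p → Matrix (Fin n) (Fin n) ℝ) : Continuous (systemMatrix A₀ A₁) := by
  unfold systemMatrix
  fun_prop

end LQR

theorem mainTheorem6_general {α : Type*} [TopologicalSpace α] {n m : ℕ}
    {A Q : α → Matrix (Fin n) (Fin n) ℝ} {B : α → Matrix (Fin n) (Fin m) ℝ}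
    {R : α → Matrix (Fin m) (Fin m) ℝ} {S : Set α} (hS : IsCompact S) (hSconn : IsPathConnected S)
    (hA : ContinuousOn A S) (hB : ContinuousOn B S) (hQ : ContinuousOn Q S) (hR : ContinuousOn R S)
    (hQpos : ∀ ρ ∈ S, (Q ρ).PosSemidef) (hRpos : ∀ ρ ∈ S, (R ρ).PosDef)
    (hstab : ∀ ρ ∈ S, LQR.Stabilizable (A ρ) (B ρ))
    (hdet : ∀ ρ ∈ S, LQR.Detectable (A ρ) (CFC.sqrt (Q ρ))) :
    (∀ ρ ∈ S,
      (LQR.careSolution (A ρ) (B ρ) (Q ρ) (R ρ)).PosSemidef ∧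
      LQR.SolvesCARE (A ρ) (B ρ) (Q ρ) (R ρ) (LQR.careSolution (A ρ) (B ρ) (Q ρ) (R ρ)) ∧
      (∀ X : Matrix (Fin n) (Fin n) ℝ, X.PosSemidef →
        LQR.SolvesCARE (A ρ) (B ρ) (Q ρ) (R ρ) X →
        X = LQR.careSolution (A ρ) (B ρ) (Q ρ) (R ρ)) ∧
      (∀ X : Matrix (Fin n) (Fin n) ℝ, X.IsSymm →
        LQR.SolvesCARE (A ρ) (B ρ) (Q ρ) (R ρ) X →
        (LQR.careSolution (A ρ) (B ρ) (Q ρ) (R ρ) - X).PosSemidef)) ∧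
    ContinuousOn (fun ρ => LQR.optimalGain (A ρ) (B ρ) (Q ρ) (R ρ)) S ∧
    IsCompact ((fun ρ => LQR.optimalGain (A ρ) (B ρ) (Q ρ) (R ρ)) '' S) ∧
    IsPathConnected ((fun ρ => LQR.optimalGain (A ρ) (B ρ) (Q ρ) (R ρ)) '' S) := by
  have hQnonneg (ρ : α) (hρ : ρ ∈ S) : 0 ≤ Q ρ := (hQpos ρ hρ).nonneg
  have hgain := LQR.continuousOn_optimalGain hA hB hQ hR hQnonneg hRpos hstab hdet
  refine ⟨fun ρ hρ => ?_, hgain, hS.image_of_continuousOn hgain, hSconn.image' hgain⟩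
  obtain ⟨hP, hCARE⟩ :=
    (hstab ρ hρ).careSolution_nonneg_and_solvesCARE (hQnonneg ρ hρ) (hRpos ρ hρ)
  exact ⟨Matrix.nonneg_iff_posSemidef.1 hP, hCARE,
    fun _ hX => (hdet ρ hρ).eq_of_solvesCARE (hQnonneg ρ hρ) (hRpos ρ hρ) hP hCARE hX.nonneg,
    fun _ => (hdet ρ hρ).le_of_solvesCARE (hQnonneg ρ hρ) (hRpos ρ hρ) hP hCARE⟩

theorem mainTheorem6 {n m p : ℕ}
    (A₀ : Matrix (Fin n) (Fin n) ℝ) (A₁ : Fin p → Matrix (Fin n) (Fin n) ℝ)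
    (B : Matrix (Fin n) (Fin m) ℝ)
    (Q : Matrix (Fin n) (Fin n) ℝ) (R : Matrix (Fin m) (Fin m) ℝ)
    (S : Set (EuclideanSpace ℝ (Fin p)))
    (hS : LQR.IsPolytope S) (hSne : S.Nonempty)
    (hR : R.PosDef) (hQ : Q.PosSemidef)
    (hstab : ∀ ρ ∈ S, LQR.Stabilizable (LQR.systemMatrix A₀ A₁ ρ) B)
    (hdet : ∀ ρ ∈ S, LQR.Detectable (LQR.systemMatrix A₀ A₁ ρ) (CFC.sqrt Q)) :
    -- `P*(ρ)` is well defined: it is the unique positive semidefinite solution of the Riccati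
    -- equation, and the maximal one among all symmetric solutions
    (∀ ρ ∈ S,
      (LQR.careSolution (LQR.systemMatrix A₀ A₁ ρ) B Q R).PosSemidef ∧
      LQR.SolvesCARE (LQR.systemMatrix A₀ A₁ ρ) B Q R
        (LQR.careSolution (LQR.systemMatrix A₀ A₁ ρ) B Q R) ∧
      (∀ X : Matrix (Fin n) (Fin n) ℝ, X.PosSemidef →
        LQR.SolvesCARE (LQR.systemMatrix A₀ A₁ ρ) B Q R X →
        X = LQR.careSolution (LQR.systemMatrix A₀ A₁ ρ) B Q R) ∧
      (∀ X : Matrix (Fin n) (Fin n) ℝ, X.IsSymm →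
        LQR.SolvesCARE (LQR.systemMatrix A₀ A₁ ρ) B Q R X →
        (LQR.careSolution (LQR.systemMatrix A₀ A₁ ρ) B Q R - X).PosSemidef)) ∧
    ContinuousOn (fun ρ => LQR.optimalGain (LQR.systemMatrix A₀ A₁ ρ) B Q R) S ∧
    IsCompact ((fun ρ => LQR.optimalGain (LQR.systemMatrix A₀ A₁ ρ) B Q R) '' S) ∧
    IsPathConnected ((fun ρ => LQR.optimalGain (LQR.systemMatrix A₀ A₁ ρ) B Q R) '' S) := by
  obtain ⟨V, hV, rfl⟩ := hS
  exact mainTheorem6_general (hV.isCompact_convexHull ℝ)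
    ((convex_convexHull ℝ V).isPathConnected hSne) (LQR.continuous_systemMatrix A₀ A₁).continuousOn
    continuousOn_const continuousOn_const continuousOn_const (fun _ _ => hQ) (fun _ _ => hR)
    hstab hdet
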